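/- Let $K$ be a perfect field of prime characteristic $p$, let $R=K[x_1,\dots,x_d]$ be the standard graded polynomial ring, and let $<$ be a monomial order on $R$. For an ideal $I\subseteq R$ write $\operatorname{in}_<(I)$ for its initial ideal and, for $n\ge 0$, $I^{(n)}=I^nR_W\cap R$ for its $n$-th symbolic power, where $W$ is the complement of the union of the minimal primes of $I$. Let $P\subseteq R$ be a homogeneous prime ideal such that $\operatorname{in}_<(P)$ is radical. Put $$S=\bigoplus_{n\ge 0}\operatorname{in}_<(P^{(n)})T^n\subseteq R[T],\qquad \mathcal J=\bigoplus_{n\ge 0}\operatorname{in}_<(P^{(n+1)})T^n\subseteq S,\qquad G=S/\mathcal J.$$ Assume that $S$ is Noetherian, and let $b_1,\dots,b_k$ be positive integers that are generating degrees of $S$ as an $R$-algebra, that is, $S=R[\operatorname{in}_<(P^{(b_1)})T^{b_1},\dots,\operatorname{in}_<(P^{(b_k)})T^{b_k}]$. Assume that $p>\operatorname{lcm}(b_1,\dots,b_k)$ and that $G$ is reduced. Then: 1. The map $\mathfrak q\mapsto Q_{\mathfrak q}:=\ker(G\to G\otimes_R R_{\mathfrak q})$ is a bijection from the set of primes of $R$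 minimal over $\operatorname{in}_<(P)$ onto the set of minimal primes of $G$, and the contraction of $Q_{\mathfrak q}$ to $R$ is $\mathfrak q$ for every such $\mathfrak q$. 2. $\operatorname{in}_<(P^{(n)})=\operatorname{in}_<(P)^{(n)}$ for all $n\ge 0$. -/

import Mathlib

open scoped Polynomial TensorProduct

/-- A (decreasing, multiplicative) filtration of a commutative ring by ideals:
`I₀ = R`, `Iₙ₊₁ ⊆ Iₙ` and `Iₘ Iₙ ⊆ Iₘ₊ₙ`. -/
structure IdealFiltration (R : Type*) [CommRing R] where
  /-- the `n`-th ideal of the filtration -/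
  toFun : ℕ → Ideal R
  zero_eq : toFun 0 = ⊤
  succ_le : ∀ n, toFun (n + 1) ≤ toFun n
  mul_le : ∀ m n, toFun m * toFun n ≤ toFun (m + n)

namespace IdealFiltration

variable {R : Type*} [CommRing R]

/-- The Rees algebra `⨁ Iₙ Tⁿ`, as a subalgebra of `R[T]`. -/
def rees (F : IdealFiltration R) : Subalgebra R R[X] where
  carrier := {f | ∀ i, f.coeff i ∈ F.toFun i}
  mul_mem' := by
    intro f g hf hg i
    rw [Polynomial.coeff_mul]
    refine Ideal.sum_mem _ fun jk hjk => ?_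
    rw [← Finset.HasAntidiagonal.mem_antidiagonal.mp hjk]
    exact F.mul_le _ _ (Ideal.mul_mem_mul (hf _) (hg _))
  add_mem' := by
    intro f g hf hg i
    rw [Polynomial.coeff_add]
    exact Ideal.add_mem _ (hf i) (hg i)
  algebraMap_mem' := by
    intro r i
    rw [Polynomial.algebraMap_apply, Polynomial.coeff_C]
    split_ifs with h
    · rw [h, F.zero_eq]
      exact Submodule.mem_top
    · exact Ideal.zero_mem _

/-- The ideal `⨁ Iₙ₊₁ Tⁿ` of the Rees algebra. -/
def shiftIdeal (F : IdealFiltration R) : Ideal F.rees where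
  carrier := {f | ∀ i, (f : R[X]).coeff i ∈ F.toFun (i + 1)}
  add_mem' := by
    intro f g hf hg i
    rw [Subalgebra.coe_add, Polynomial.coeff_add]
    exact Ideal.add_mem _ (hf i) (hg i)
  zero_mem' := by
    intro i
    rw [Subalgebra.coe_zero, Polynomial.coeff_zero]
    exact Ideal.zero_mem _
  smul_mem' := by
    intro f g hg i
    rw [smul_eq_mul, Subalgebra.coe_mul, Polynomial.coeff_mul]
    refine Ideal.sum_mem _ fun jk hjk => ?_
    rw [← Finset.HasAntidiagonal.mem_antidiagonal.mp hjk, add_assoc]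
    exact F.mul_le _ _ (Ideal.mul_mem_mul (f.2 _) (hg _))

/-- The associated graded algebra `⨁ Iₙ / Iₙ₊₁`, as the quotient of the Rees algebra
by `⨁ Iₙ₊₁ Tⁿ`. -/
def gr (F : IdealFiltration R) : Type _ := F.rees ⧸ F.shiftIdeal

noncomputable instance instCommRingGr (F : IdealFiltration R) : CommRing F.gr :=
  inferInstanceAs (CommRing (F.rees ⧸ F.shiftIdeal))

noncomputable instance instAlgebraGr (F : IdealFiltration R) : Algebra R F.gr :=
  inferInstanceAs (Algebra R (F.rees ⧸ F.shiftIdeal))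

/-- The positive integers `b₁, …, bₖ` are generating degrees of the Rees algebra over `R`:
`⨁ Iₙ Tⁿ = R[I_{b₁} T^{b₁}, …, I_{bₖ} T^{bₖ}]`. -/
def GeneratingDegrees (F : IdealFiltration R) {k : ℕ} (b : Fin k → ℕ) : Prop :=
  (∀ i, 0 < b i) ∧
    Algebra.adjoin R {g : R[X] | ∃ i, ∃ f ∈ F.toFun (b i), g = Polynomial.monomial (b i) f} =
      F.rees

/-- The kernel of the localization map `gr F → gr F ⊗_R R_q` at a prime `q` of `R`. -/
noncomputable def grLocalizationKer (F : IdealFiltration R) (q : Ideal R) [q.IsPrime] :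
    Ideal F.gr :=
  RingHom.ker (Algebra.TensorProduct.includeLeftRingHom :
    F.gr →+* F.gr ⊗[R] Localization.AtPrime q)

end IdealFiltration

section SymbolicPower

variable {R : Type*} [CommRing R]

/-- The complement of the union of the minimal primes of `I`. -/
def minimalPrimesCompl (I : Ideal R) : Submonoid R where
  carrier := {s | ∀ p ∈ I.minimalPrimes, s ∉ p}
  one_mem' := fun p hp h1 => hp.1.1.ne_top ((Ideal.eq_top_iff_one p).mpr h1)
  mul_mem' := fun ha hb p hp hab => (hp.1.1.mem_or_mem hab).elim (ha p hp) (hb p hp)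

/-- The `n`-th symbolic power `I^(n) = Iⁿ R_W ∩ R`, where `W` is the complement of the union
of the minimal primes of `I`. -/
noncomputable def symbolicPower (I : Ideal R) (n : ℕ) : Ideal R :=
  ((I ^ n).map (algebraMap R (Localization (minimalPrimesCompl I)))).comap
    (algebraMap R (Localization (minimalPrimesCompl I)))

/-- The filtration by symbolic powers. -/
noncomputable def symbolicFiltration (I : Ideal R) : IdealFiltration R where
  toFun := symbolicPower I
  zero_eq := by
    rw [symbolicPower, pow_zero, Ideal.one_eq_top, Ideal.map_top, Ideal.comap_top]
  succ_le := fun n => Ideal.comap_mono (Ideal.map_mono (Ideal.pow_le_pow_right n.le_succ))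
  mul_le := fun m n => by
    unfold symbolicPower
    rw [pow_add, Ideal.map_mul]
    exact Ideal.le_comap_mul _

end SymbolicPower

section InitialIdeal

variable {K : Type*} [Field K] {σ : Type*} (ord : MonomialOrder σ)

/-- The initial ideal of `I` with respect to a monomial order. -/
noncomputable def initialIdeal (I : Ideal (MvPolynomial σ K)) : Ideal (MvPolynomial σ K) :=
  Ideal.span (ord.leadingTerm '' (I : Set (MvPolynomial σ K)))

/-- The filtration of initial ideals of a filtration. -/
noncomputable def initialFiltration (F : IdealFiltration (MvPolynomial σ K)) :
    IdealFiltration (MvPolynomial σ K) where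
  toFun := fun n => initialIdeal ord (F.toFun n)
  zero_eq := by
    rw [Ideal.eq_top_iff_one]
    refine Ideal.subset_span ⟨1, ?_, ?_⟩
    · rw [F.zero_eq]
      exact Submodule.mem_top
    · rw [← MvPolynomial.C_1]
      exact ord.leadingTerm_C 1
  succ_le := fun n => Ideal.span_mono (Set.image_mono (F.succ_le n))
  mul_le := fun m n => by
    unfold initialIdeal
    rw [Ideal.span_mul_span', Ideal.span_le]
    rintro _ ⟨_, ⟨f, hf, rfl⟩, _, ⟨g, hg, rfl⟩, rfl⟩
    exact Ideal.subset_span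
      ⟨f * g, F.mul_le m n (Ideal.mul_mem_mul hf hg), ord.leadingTerm_mul f g⟩

end InitialIdeal

attribute [local instance] MvPolynomial.gradedAlgebra

/-!
Write `I` for the initial ideal of `P` and `Aₙ` for the initial ideal of the `n`-th symbolic power
of `P`. All `Aₙ` are monomial ideals, `A₁ = I`, and the minimal primes `q` of `I` are generated by
variables. Since `I` is radical, a polynomial lies in the `n`-th symbolic power of `I` exactly if
for every `q` each of its monomials has degree at least `n` in the variables of `q`
(`mem_symbolicPower_iff_forall_le_weightOrder`).

*The inclusion of `Aₙ` in the symbolic power of `I`.* By Taylor expansion, divided-power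
derivatives of order less than `n` map the `n`-th symbolic power of `P` into `P`. If the leading
monomial `m` of an element had degree less than `n` in the variables of `q`, differentiating by the
part of `m` in these variables would give an element of `P` whose leading monomial is prime to
them, although it lies in `I ⊆ q` (`le_weight_degree_of_mem_symbolicPower`).

*The opposite inclusion.* Let `v c` be the largest `n` with `x^c ∈ Aₙ`. This function is
superadditive. It is homogeneous because the associated graded algebra is reduced, and it grows by
a bounded amount under translations because the Rees algebra is generated in bounded degrees.
Taking directional derivatives along a given exponent and then along all the coordinate directions
makes such a function additive while keeping its value at the given exponent, so `v` is a minimum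
of linear functions with *integer* coefficients (`IsHomogeneousSuperadditive.exists_weight`).
The support of each of these linear functions contains the variables of some `q`, as otherwise the
product of the remaining variables would lie in `I = A₁`. Being integral, the linear function is
therefore at least the degree in the variables of `q`
(`symbolicPower_le_of_isReduced_gr`).

*Minimal primes.* Once `Aₙ` is the symbolic power of `I`, the kernel of localization at `q` consists
of the classes whose components vanish along `q` to higher order than their degree. It is prime
because the order of vanishing along `q` is a valuation, it contracts to `q`, and the kernels for
the various `q` intersect in zero (`exists_equiv_minimalPrimes_gr`).
-/

/-! ### Superadditive homogeneous functions and their supporting weights -/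

/-- An `ℕ`-valued function on a commutative monoid that is superadditive, homogeneous, and grows
by a bounded amount under each translation. -/
structure IsHomogeneousSuperadditive {M : Type*} [AddCommMonoid M] (v : M → ℕ) : Prop where
  add_le : ∀ a c, v a + v c ≤ v (a + c)
  map_nsmul : ∀ (k : ℕ) a, v (k • a) = k * v a
  exists_bound : ∀ c, ∃ B, ∀ a, v (a + c) ≤ v a + B

namespace IsHomogeneousSuperadditive

variable {M : Type*} [AddCommMonoid M] {v : M → ℕ}

/-- The sequence `j ↦ v (j u + c) - j v(u)` is nondecreasing and bounded, hence eventually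
constant. -/
theorem exists_eventually_eq (hv : IsHomogeneousSuperadditive v) (u c : M) :
    ∃ t J : ℕ, ∀ j, J ≤ j → v (j • u + c) = j * v u + t := by
  obtain ⟨B, hB⟩ := hv.exists_bound c
  have hmono : Monotone fun j : ℕ => v (j • u + c) - j * v u := by
    refine monotone_nat_of_le_succ fun j => ?_
    have h := hv.add_le (j • u + c) u
    rw [show j • u + c + u = (j + 1) • u + c by rw [succ_nsmul]; abel] at h
    simp only [add_mul, one_mul]
    omega
  have hlow : ∀ j : ℕ, j * v u ≤ v (j • u + c) := fun j => by
    have h := hv.add_le (j • u) c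
    rw [hv.map_nsmul] at h
    omega
  have hup : ∀ j : ℕ, v (j • u + c) - j * v u ≤ B := fun j => by
    have h := hB (j • u)
    rw [hv.map_nsmul] at h
    omega
  obtain ⟨J, hJ⟩ : ∃ J, ∀ j, v (j • u + c) - j * v u ≤ v (J • u + c) - J * v u := by
    have hbdd : BddAbove (Set.range fun j : ℕ => v (j • u + c) - j * v u) :=
      ⟨B, by rintro _ ⟨j, rfl⟩; exact hup j⟩
    obtain ⟨J, hJ⟩ := Nat.sSup_mem (Set.range_nonempty _) hbdd
    refine ⟨J, fun j => ?_⟩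
    have hJ' : v (J • u + c) - J * v u = _ := hJ
    rw [hJ']
    exact le_csSup hbdd ⟨j, rfl⟩
  refine ⟨v (J • u + c) - J * v u, J, fun j hj => ?_⟩
  have h1 := hJ j
  have h2 : v (J • u + c) - J * v u ≤ v (j • u + c) - j * v u := hmono hj
  have h3 := hlow j
  omega

/-- The directional derivative of `v` along `u` dominates `v`, agrees with `v` at `u`, is additive
along `u`, and stays unchanged and additive along directions where `v` already is additive. -/
theorem exists_additive_along (hv : IsHomogeneousSuperadditive v) (u : M) :
    ∃ w : M → ℕ, IsHomogeneousSuperadditive w ∧ (∀ c, v c ≤ w c) ∧ w u = v u ∧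
      (∀ c, w (c + u) = w c + w u) ∧
      ∀ m, (∀ c, v (c + m) = v c + v m) → w m = v m ∧ ∀ c, w (c + m) = w c + w m := by
  choose w J hw using hv.exists_eventually_eq u
  -- `w c` is read off at a single index beyond the threshold for `c`
  have hval : ∀ c t j, J c ≤ j → v (j • u + c) = j * v u + t → w c = t := fun c t j hj h => by
    have := hw c j hj
    omega
  have hadd : ∀ m, (∀ c, v (c + m) = v c + v m) → ∀ c, w (c + m) = w c + v m := by
    intro m hm c
    refine hval _ _ (J c + J (c + m)) (by omega) ?_
    rw [← add_assoc, hm, hw c _ (by omega), add_assoc]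
  have h0 : w 0 = 0 := by
    refine hval _ _ (J 0) le_rfl ?_
    rw [add_zero, hv.map_nsmul, add_zero]
  have hu : ∀ c, w (c + u) = w c + v u := by
    intro c
    refine hval _ _ (J c + J (c + u)) (by omega) ?_
    have h := hw c (J c + J (c + u) + 1) (by omega)
    rw [show (J c + J (c + u) + 1) • u + c = (J c + J (c + u)) • u + (c + u) by
      rw [succ_nsmul]; abel] at h
    rw [h]
    ring
  have huu : w u = v u := by simpa [h0] using hu 0
  refine ⟨w, ⟨?_, ?_, ?_⟩, ?_, huu, fun c => by rw [hu, huu], ?_⟩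
  · intro a c
    have ha := hw a (J a + J c + J (a + c)) (by omega)
    have hc := hw c (J a + J c + J (a + c)) (by omega)
    have hac := hw (a + c) ((J a + J c + J (a + c)) + (J a + J c + J (a + c))) (by omega)
    have h := hv.add_le ((J a + J c + J (a + c)) • u + a) ((J a + J c + J (a + c)) • u + c)
    rw [add_add_add_comm, ← add_nsmul] at h
    rw [add_mul] at hac
    omega
  · intro k a
    rcases Nat.eq_zero_or_pos k with rfl | hk
    · simp [h0]
    refine hval _ _ (k * (J a + J (k • a))) (by nlinarith) ?_
    rw [mul_nsmul', ← nsmul_add, hv.map_nsmul, hw a _ (by omega)]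
    ring
  · intro c
    obtain ⟨B, hB⟩ := hv.exists_bound c
    refine ⟨B, fun a => ?_⟩
    have ha := hw a (J a + J (a + c)) (by omega)
    have hac := hw (a + c) (J a + J (a + c)) (by omega)
    have h := hB ((J a + J (a + c)) • u + a)
    rw [← add_assoc] at hac
    omega
  · intro c
    have hc := hw c (J c) le_rfl
    have h := hv.add_le (J c • u) c
    rw [hv.map_nsmul] at h
    omega
  · intro m hm
    have hmm : w m = v m := by simpa [h0] using hadd m hm 0
    exact ⟨hmm, fun c => by rw [hadd m hm, hmm]⟩

theorem exists_additive_along_finset (hv : IsHomogeneousSuperadditive v) (m : M) (s : Finset M) :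
    ∃ w : M → ℕ, IsHomogeneousSuperadditive w ∧ (∀ c, v c ≤ w c) ∧ w m = v m ∧
      (∀ c, w (c + m) = w c + w m) ∧ ∀ x ∈ s, ∀ c, w (c + x) = w c + w x := by
  classical
  induction s using Finset.induction_on with
  | empty =>
    obtain ⟨w, h1, h2, h3, h4, -⟩ := hv.exists_additive_along m
    exact ⟨w, h1, h2, h3, h4, by simp⟩
  | insert y s _ ih =>
    obtain ⟨w, h1, h2, h3, h4, h5⟩ := ih
    obtain ⟨w', g1, g2, -, g4, g5⟩ := h1.exists_additive_along y
    refine ⟨w', g1, fun c => (h2 c).trans (g2 c), (g5 m h4).1.trans h3, (g5 m h4).2, ?_⟩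
    intro x hx
    rcases Finset.mem_insert.mp hx with rfl | hx
    · exact g4
    · exact (g5 x (h5 x hx)).2

/-- On `ℕ^σ`, a homogeneous superadditive function is the lower envelope of integral weights:
at every point some weight that dominates the function everywhere agrees with it. -/
theorem exists_weight {σ : Type*} [Fintype σ] {v : (σ →₀ ℕ) → ℕ}
    (hv : IsHomogeneousSuperadditive v) (m : σ →₀ ℕ) :
    ∃ a : σ → ℕ, (∀ c, v c ≤ Finsupp.weight a c) ∧ Finsupp.weight a m = v m := by
  classical
  obtain ⟨w, h1, h2, h3, -, h5⟩ :=
    hv.exists_additive_along_finset m (Finset.univ.image fun i : σ => Finsupp.single i 1)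
  have hw : ∀ c, w c = Finsupp.weight (fun i => w (Finsupp.single i 1)) c := by
    intro c
    induction c using Finsupp.induction_linear with
    | zero => simpa using h1.map_nsmul 0 0
    | add f g hf hg =>
      have key : ∀ g f : σ →₀ ℕ, w (f + g) = w f + w g := by
        intro g
        induction g using Finsupp.induction_linear with
        | zero => simpa using h1.map_nsmul 0 0
        | add g g' hg hg' =>
          intro f
          rw [← add_assoc, hg', hg, hg', add_assoc]
        | single i k =>
          induction k with
          | zero => simpa using h1.map_nsmul 0 0
          | succ k ih =>
            intro f
            have hi := h5 (Finsupp.single i 1) (by simp)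
            rw [Finsupp.single_add, ← add_assoc, hi, ih, hi, add_assoc]
      rw [key, hf, hg, map_add]
    | single i k =>
      rw [Finsupp.weight_single, smul_eq_mul, ← h1.map_nsmul]; simp
  exact ⟨_, fun c => hw c ▸ h2 c, by rw [← hw, h3]⟩

end IsHomogeneousSuperadditive

/-! ### Filtrations with reduced associated graded algebra -/

namespace IdealFiltration

variable {R : Type*} [CommRing R] (F : IdealFiltration R)

theorem antitone : Antitone F.toFun := antitone_nat_of_succ_le F.succ_le

theorem pow_mem {f : R} {n : ℕ} (hf : f ∈ F.toFun n) (k : ℕ) : f ^ k ∈ F.toFun (k * n) := by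
  induction k with
  | zero => simp [F.zero_eq]
  | succ k ih =>
    rw [pow_succ, add_mul, one_mul]
    exact F.mul_le _ _ (Ideal.mul_mem_mul ih hf)

/-- The projection of the Rees algebra onto the associated graded algebra. -/
noncomputable def toGr : F.rees →+* F.gr := Ideal.Quotient.mk F.shiftIdeal

theorem toGr_surjective : Function.Surjective F.toGr := Ideal.Quotient.mk_surjective

theorem toGr_eq_zero_iff (x : F.rees) :
    F.toGr x = 0 ↔ ∀ n, (x : R[X]).coeff n ∈ F.toFun (n + 1) :=
  Ideal.Quotient.eq_zero_iff_mem

theorem algebraMap_gr (r : R) : algebraMap R F.gr r = F.toGr (algebraMap R F.rees r) := rfl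

theorem smul_toGr (r : R) (x : F.rees) : r • F.toGr x = F.toGr (r • x) := rfl

theorem monomial_mem_rees {f : R} {n : ℕ} (hf : f ∈ F.toFun n) :
    Polynomial.monomial n f ∈ F.rees := by
  intro i
  rw [Polynomial.coeff_monomial]
  split_ifs with h
  · exact h ▸ hf
  · exact Ideal.zero_mem _

/-- If the associated graded algebra is reduced, no power of an element lies deeper in the
filtration than the element forces. -/
theorem mem_succ_of_pow_mem [IsReduced F.gr] {f : R} {n k : ℕ} (hf : f ∈ F.toFun n)
    (hk : f ^ k ∈ F.toFun (k * n + 1)) : f ∈ F.toFun (n + 1) := by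
  let x : F.rees := ⟨Polynomial.monomial n f, F.monomial_mem_rees hf⟩
  have hx : F.toGr x ^ k = 0 := by
    rw [← map_pow, toGr_eq_zero_iff]
    intro i
    rw [SubmonoidClass.coe_pow, Polynomial.monomial_pow, Polynomial.coeff_monomial, mul_comm n]
    split_ifs with h
    · exact h ▸ hk
    · exact Ideal.zero_mem _
  have h := (F.toGr_eq_zero_iff x).mp (IsReduced.eq_zero _ ⟨k, hx⟩) n
  simpa [x] using h

end IdealFiltration

/-! ### Monomial ideals and filtrations -/

section MonomialIdeal

open MvPolynomial

variable {K : Type*} [Field K] {σ : Type*}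

/-- An ideal of a polynomial ring is monomial if it contains the monomials of its elements. -/
def IsMonomialIdeal (I : Ideal (MvPolynomial σ K)) : Prop :=
  ∀ f ∈ I, ∀ u ∈ f.support, monomial u (1 : K) ∈ I

theorem mem_of_forall_monomial_mem {I : Ideal (MvPolynomial σ K)} {f : MvPolynomial σ K}
    (h : ∀ u ∈ f.support, monomial u (1 : K) ∈ I) : f ∈ I := by
  rw [f.as_sum]
  refine Ideal.sum_mem _ fun u hu => ?_
  rw [← mul_one (coeff u f), ← C_mul_monomial]
  exact Ideal.mul_mem_left _ _ (h u hu)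

variable {A : IdealFiltration (MvPolynomial σ K)}

theorem IdealFiltration.monomial_add_mem {u c : σ →₀ ℕ} {m n : ℕ}
    (hu : monomial u (1 : K) ∈ A.toFun m) (hc : monomial c (1 : K) ∈ A.toFun n) :
    monomial (u + c) (1 : K) ∈ A.toFun (m + n) := by
  rw [← one_mul (1 : K), ← monomial_mul]
  exact A.mul_le _ _ (Ideal.mul_mem_mul hu hc)

/-- Finite generation makes division by a variable lose only a bounded number of filtration
steps: if `Aₙ` is a sum of products of the `A_{bᵢ}`, dividing by a variable removes at most one
factor. -/
theorem exists_bound_of_generatingDegrees (hA : ∀ n, IsMonomialIdeal (A.toFun n)) {k : ℕ}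
    {b : Fin k → ℕ} (hb : A.GeneratingDegrees b) :
    ∃ B, ∀ n (u : σ →₀ ℕ) (i : σ), monomial (u + Finsupp.single i 1) (1 : K) ∈ A.toFun n →
      monomial u (1 : K) ∈ A.toFun (n - B) := by
  classical
  set B := Finset.univ.sup b with hB
  -- the elements of the Rees algebra for which the claim holds form a subalgebra
  have key : ∀ g ∈ Algebra.adjoin (MvPolynomial σ K)
      {g : (MvPolynomial σ K)[X] | ∃ i, ∃ f ∈ A.toFun (b i), g = Polynomial.monomial (b i) f},
      ∀ n, ∀ c ∈ (g.coeff n).support, monomial c (1 : K) ∈ A.toFun n ∧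
        ∀ u i, c = u + Finsupp.single i 1 → monomial u (1 : K) ∈ A.toFun (n - B) := by
    intro g hg
    induction hg using Algebra.adjoin_induction with
    | mem g hg =>
      obtain ⟨j, f, hf, rfl⟩ := hg
      intro n c hc
      rw [Polynomial.coeff_monomial] at hc
      split_ifs at hc with h
      · subst h
        refine ⟨hA _ f hf c hc, fun u i _ => ?_⟩
        rw [Nat.sub_eq_zero_of_le (Finset.le_sup (f := b) (Finset.mem_univ j)), A.zero_eq]
        trivial
      · simp at hc
    | algebraMap r =>
      intro n c hc
      rw [Polynomial.algebraMap_apply, Polynomial.coeff_C] at hc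
      split_ifs at hc with h
      · subst h
        simp [A.zero_eq]
      · simp at hc
    | add g h _ _ ihg ihh =>
      intro n c hc
      rw [Polynomial.coeff_add] at hc
      rcases Finset.mem_union.mp (support_add hc) with hc | hc
      · exact ihg n c hc
      · exact ihh n c hc
    | mul g h _ _ ihg ihh =>
      intro n c hc
      rw [Polynomial.coeff_mul] at hc
      obtain ⟨⟨s, t⟩, hst, hc⟩ := Finset.mem_biUnion.mp (support_sum hc)
      obtain ⟨c₁, h₁, c₂, h₂, rfl⟩ := Finset.mem_add.mp (support_mul _ _ hc)
      obtain rfl : s + t = n := by simpa using hst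
      refine ⟨IdealFiltration.monomial_add_mem (ihg s c₁ h₁).1 (ihh t c₂ h₂).1,
        fun u i hu => ?_⟩
      have hi : c₁ i ≠ 0 ∨ c₂ i ≠ 0 := by
        have := DFunLike.congr_fun hu i
        simp at this
        omega
      have hle : ∀ c : σ →₀ ℕ, c i ≠ 0 → c = (c - Finsupp.single i 1) + Finsupp.single i 1 :=
        fun c hc => (Finsupp.sub_add_single_one_cancel hc).symm
      rcases hi with hi | hi
      · have h := (ihg s c₁ h₁).2 _ i (hle _ hi)
        rw [hle c₁ hi, add_right_comm] at hu
        rw [← add_right_cancel hu]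
        exact A.antitone (by omega) (IdealFiltration.monomial_add_mem h (ihh t c₂ h₂).1)
      · have h := (ihh t c₂ h₂).2 _ i (hle _ hi)
        rw [hle c₂ hi, ← add_assoc] at hu
        rw [← add_right_cancel hu]
        exact A.antitone (by omega) (IdealFiltration.monomial_add_mem (ihg s c₁ h₁).1 h)
  refine ⟨B, fun n u i hu => ?_⟩
  have hmem := A.monomial_mem_rees hu
  rw [← hb.2] at hmem
  exact (key _ hmem n (u + Finsupp.single i 1) (by simp [support_monomial])).2 u i rfl

/-- A monomial filtration with reduced associated graded algebra and finitely generated Rees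
algebra is cut out by integral weights: through every exponent `u` there passes a weight `a`
such that `x^c ∈ Aₙ` implies `n ≤ a · c`, while `x^u` does lie in `Aₙ` for `n = a · u`. -/
theorem exists_weight_of_isReduced_gr [Fintype σ] (hA : ∀ n, IsMonomialIdeal (A.toFun n)) {k : ℕ}
    {b : Fin k → ℕ} (hb : A.GeneratingDegrees b) [IsReduced A.gr]
    (hfin : ∀ u : σ →₀ ℕ, ∃ N, ∀ n, monomial u (1 : K) ∈ A.toFun n → n ≤ N) (u : σ →₀ ℕ) :
    ∃ a : σ → ℕ, (∀ c n, monomial c (1 : K) ∈ A.toFun n → n ≤ Finsupp.weight a c) ∧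
      monomial u (1 : K) ∈ A.toFun (Finsupp.weight a u) := by
  classical
  have hex : ∀ c : σ →₀ ℕ, ∃ t, ∀ n, monomial c (1 : K) ∈ A.toFun n ↔ n ≤ t := by
    intro c
    obtain ⟨N, hN⟩ := hfin c
    refine ⟨Nat.findGreatest (fun n => monomial c (1 : K) ∈ A.toFun n) N, fun n =>
      ⟨fun h => Nat.le_findGreatest (hN n h) h, fun h => A.antitone h ?_⟩⟩
    refine Nat.findGreatest_spec (P := fun n => monomial c (1 : K) ∈ A.toFun n)
      (Nat.zero_le N) ?_
    simp [A.zero_eq]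
  -- `v c` is the largest `n` with `x^c ∈ Aₙ`
  choose v hv using hex
  have hadd : ∀ a c, v a + v c ≤ v (a + c) := fun a c =>
    (hv _ _).mp (IdealFiltration.monomial_add_mem ((hv _ _).mpr le_rfl) ((hv _ _).mpr le_rfl))
  have hnsmul_le : ∀ (k : ℕ) c, k * v c ≤ v (k • c) := fun k c => by
    have h := A.pow_mem ((hv c _).mpr le_rfl) k
    rw [monomial_pow, one_pow] at h
    exact (hv _ _).mp h
  have hnsmul : ∀ (k : ℕ) c, v (k • c) = k * v c := by
    intro k c
    refine le_antisymm (not_lt.mp fun hlt => ?_) (hnsmul_le k c)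
    have h : monomial c (1 : K) ^ k ∈ A.toFun (k * v c + 1) := by
      rw [monomial_pow, one_pow]
      exact (hv _ _).mpr hlt
    have h' := A.mem_succ_of_pow_mem ((hv c _).mpr le_rfl) h
    have := (hv _ _).mp h'
    omega
  obtain ⟨B, hB⟩ := exists_bound_of_generatingDegrees hA hb
  have hbound : ∀ c, ∃ B, ∀ a, v (a + c) ≤ v a + B := by
    intro c
    induction c using Finsupp.induction_linear with
    | zero => exact ⟨0, by simp⟩
    | add f g hf hg =>
      obtain ⟨B₁, h₁⟩ := hf
      obtain ⟨B₂, h₂⟩ := hg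
      refine ⟨B₁ + B₂, fun a => ?_⟩
      have := h₁ a
      have := h₂ (a + f)
      rw [← add_assoc]
      omega
    | single i k =>
      induction k with
      | zero => exact ⟨0, by simp⟩
      | succ k ih =>
        obtain ⟨B', h'⟩ := ih
        refine ⟨B' + B, fun a => ?_⟩
        have h := (hv _ _).mp (hB _ (a + Finsupp.single i k) i ((hv _ _).mpr le_rfl))
        have := h' a
        rw [Finsupp.single_add, ← add_assoc]
        omega
  obtain ⟨a, ha, hau⟩ := IsHomogeneousSuperadditive.exists_weight ⟨hadd, hnsmul, hbound⟩ u
  exact ⟨a, fun c n h => ((hv _ _).mp h).trans (ha c), (hv _ _).mpr hau.le⟩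

end MonomialIdeal

/-! ### Symbolic powers and orders of vanishing -/

section WeightedOrder

open MvPolynomial

variable {σ D : Type*} [CommRing D]

/-- The least weight of a monomial occurring in a polynomial (`⊤` for the zero polynomial). -/
noncomputable def weightOrder (w : σ → ℕ) (f : MvPolynomial σ D) : ℕ∞ :=
  (f : MvPowerSeries σ D).weightedOrder w

theorem le_weightOrder_iff {w : σ → ℕ} {f : MvPolynomial σ D} {n : ℕ} :
    (n : ℕ∞) ≤ weightOrder w f ↔ ∀ u ∈ f.support, n ≤ Finsupp.weight w u := by
  constructor
  · intro h u hu
    by_contra hlt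
    refine mem_support_iff.mp hu ?_
    rw [← coeff_coe]
    refine MvPowerSeries.coeff_eq_zero_of_lt_weightedOrder w (lt_of_lt_of_le ?_ h)
    exact_mod_cast not_le.mp hlt
  · intro h
    refine MvPowerSeries.nat_le_weightedOrder w fun u hu => ?_
    rw [coeff_coe]
    by_contra hne
    exact absurd (h u (mem_support_iff.mpr hne)) (not_le.mpr hu)

theorem weightOrder_mul [IsDomain D] (w : σ → ℕ) (f g : MvPolynomial σ D) :
    weightOrder w (f * g) = weightOrder w f + weightOrder w g := by
  rw [weightOrder, coe_mul, MvPowerSeries.weightedOrder_mul]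
  rfl

theorem min_weightOrder_le_add (w : σ → ℕ) (f g : MvPolynomial σ D) :
    min (weightOrder w f) (weightOrder w g) ≤ weightOrder w (f + g) := by
  rw [weightOrder, weightOrder, weightOrder, coe_add]
  exact MvPowerSeries.min_weightedOrder_le_add w

theorem weightOrder_zero (w : σ → ℕ) : weightOrder w (0 : MvPolynomial σ D) = ⊤ := by
  rw [weightOrder, coe_zero, MvPowerSeries.weightedOrder_zero]

/-- The ideal of polynomials all of whose monomials have weight at least `n`. -/
noncomputable def weightIdeal [IsDomain D] (w : σ → ℕ) (n : ℕ∞) : Ideal (MvPolynomial σ D) where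
  carrier := {f | n ≤ weightOrder w f}
  add_mem' hf hg := (le_min hf hg).trans (min_weightOrder_le_add w _ _)
  zero_mem' := by
    rw [Set.mem_ofPred_eq, weightOrder_zero]
    exact le_top
  smul_mem' f g hg := by
    rw [Set.mem_ofPred_eq, smul_eq_mul, weightOrder_mul]
    exact le_add_left hg

theorem mem_weightIdeal [IsDomain D] {w : σ → ℕ} {n : ℕ∞} {f : MvPolynomial σ D} :
    f ∈ weightIdeal w n ↔ n ≤ weightOrder w f := Iff.rfl

theorem isPrime_weightIdeal_one [IsDomain D] (w : σ → ℕ) :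
    (weightIdeal w 1 : Ideal (MvPolynomial σ D)).IsPrime := by
  refine ⟨?_, ?_⟩
  · rw [Ne, Ideal.eq_top_iff_one, mem_weightIdeal]
    intro h
    have := (le_weightOrder_iff (n := 1)).mp (by exact_mod_cast h) 0 (by simp)
    simp at this
  · intro f g h
    simp only [mem_weightIdeal, weightOrder_mul, Order.one_le_iff_ne_zero] at h ⊢
    by_contra! hfg
    exact h (by rw [hfg.1, hfg.2, add_zero])

end WeightedOrder

section SymbolicPowerOrder

open MvPolynomial

variable {R : Type*} [CommRing R]

theorem mem_symbolicPower_iff {I : Ideal R} {n : ℕ} {f : R} :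
    f ∈ symbolicPower I n ↔ ∃ s ∈ minimalPrimesCompl I, s * f ∈ I ^ n := by
  rw [symbolicPower, Ideal.mem_comap,
    IsLocalization.algebraMap_mem_map_algebraMap_iff (minimalPrimesCompl I)]

theorem symbolicPower_one_of_isPrime {P : Ideal R} (hP : P.IsPrime) : symbolicPower P 1 = P := by
  ext f
  rw [mem_symbolicPower_iff, pow_one]
  constructor
  · rintro ⟨s, hs, hsf⟩
    exact (hP.mem_or_mem hsf).resolve_left
      (hs P (by rw [Ideal.minimalPrimes_eq_subsingleton_self]; rfl))
  · exact fun hf => ⟨1, one_mem _, by rwa [one_mul]⟩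

/-- An order of vanishing that is positive on `I` and zero off a minimal prime of `I` is at least
`n` on the `n`-th symbolic power of `I`. -/
theorem le_weightOrder_of_mem_symbolicPower {τ D : Type*} [CommRing D] [IsDomain D]
    {I q : Ideal R} (hq : q ∈ I.minimalPrimes) (ψ : R →+* MvPolynomial τ D) (w : τ → ℕ)
    (hI : ∀ f ∈ I, 1 ≤ weightOrder w (ψ f)) (hs : ∀ s, s ∉ q → weightOrder w (ψ s) = 0)
    {f : R} {n : ℕ} (hf : f ∈ symbolicPower I n) : (n : ℕ∞) ≤ weightOrder w (ψ f) := by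
  have hpow : ∀ n : ℕ, I ^ n ≤ (weightIdeal w n).comap ψ := by
    intro n
    induction n with
    | zero => intro f _; simp [mem_weightIdeal]
    | succ n ih =>
      rw [pow_succ, Ideal.mul_le]
      intro f hf g hg
      rw [Ideal.mem_comap, mem_weightIdeal, map_mul, weightOrder_mul, Nat.cast_succ]
      exact add_le_add (ih hf) (hI g hg)
  obtain ⟨s, hsW, hsf⟩ := mem_symbolicPower_iff.mp hf
  have h := hpow n hsf
  rwa [Ideal.mem_comap, mem_weightIdeal, map_mul, weightOrder_mul, hs s (hsW q hq),
    zero_add] at h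

end SymbolicPowerOrder

/-! ### Symbolic powers of monomial ideals -/

section MonomialPrime

open MvPolynomial

variable {K : Type*} [Field K] {σ : Type*} {I q : Ideal (MvPolynomial σ K)}

open Classical in
/-- The indicator weight of the variables contained in `q`. -/
noncomputable def primeWeight (q : Ideal (MvPolynomial σ K)) (i : σ) : ℕ :=
  if X i ∈ q then 1 else 0

theorem monomial_mem_iff_of_isPrime (hq : q.IsPrime) (u : σ →₀ ℕ) :
    monomial u (1 : K) ∈ q ↔ ∃ i, u i ≠ 0 ∧ X i ∈ q := by
  rw [monomial_eq, C_1, one_mul, Finsupp.prod, hq.prod_mem_iff]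
  constructor
  · rintro ⟨i, hi, h⟩
    exact ⟨i, Finsupp.mem_support_iff.mp hi, hq.mem_of_pow_mem _ h⟩
  · rintro ⟨i, hi, h⟩
    exact ⟨i, Finsupp.mem_support_iff.mpr hi, Ideal.pow_mem_of_mem _ h _ (Nat.pos_of_ne_zero hi)⟩

theorem one_le_weight_primeWeight_iff (u : σ →₀ ℕ) :
    1 ≤ Finsupp.weight (primeWeight q) u ↔ ∃ i, u i ≠ 0 ∧ X i ∈ q := by
  rw [Nat.one_le_iff_ne_zero, Finsupp.weight_apply, Finsupp.sum, Ne, Finset.sum_eq_zero_iff]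
  simp only [Finsupp.mem_support_iff, primeWeight, smul_eq_mul, mul_ite, mul_one, mul_zero]
  push Not
  exact exists_congr fun i => by split_ifs <;> simp_all

/-- The minimal primes of a monomial ideal are generated by variables. -/
theorem mem_iff_one_le_weightOrder (hI : IsMonomialIdeal I) (hq : q ∈ I.minimalPrimes)
    (f : MvPolynomial σ K) : f ∈ q ↔ 1 ≤ weightOrder (primeWeight q) f := by
  have hmem : ∀ f : MvPolynomial σ K, f ∈ weightIdeal (primeWeight q) 1 ↔
      ∀ u ∈ f.support, monomial u (1 : K) ∈ q := fun f => by
    rw [mem_weightIdeal, ← Nat.cast_one, le_weightOrder_iff]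
    simp only [one_le_weight_primeWeight_iff, monomial_mem_iff_of_isPrime hq.1.1]
  have hle : weightIdeal (primeWeight q) 1 ≤ q := fun f hf =>
    mem_of_forall_monomial_mem ((hmem f).mp hf)
  have hIle : I ≤ weightIdeal (primeWeight q) 1 := fun f hf =>
    (hmem f).mpr fun u hu => hq.1.2 (hI f hf u hu)
  exact ⟨fun hf => hq.2 ⟨isPrime_weightIdeal_one _, hIle⟩ hle hf, fun hf => hle hf⟩

theorem weightOrder_eq_zero_of_notMem (hI : IsMonomialIdeal I) (hq : q ∈ I.minimalPrimes)
    {s : MvPolynomial σ K} (hs : s ∉ q) : weightOrder (primeWeight q) s = 0 := by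
  rwa [mem_iff_one_le_weightOrder hI hq, Order.one_le_iff_ne_zero, not_not] at hs

/-- For a radical monomial ideal `I` with minimal prime `q`, the product `s` of the variables
outside `q` satisfies `s q ⊆ I`, and hence moves the `n`-th power of `q` into `Iⁿ` when raised to
the `n`-th power. -/
theorem exists_notMem_forall_pow_mul_mem [Fintype σ] (hI : IsMonomialIdeal I) (hrad : I.IsRadical)
    (hq : q ∈ I.minimalPrimes) :
    ∃ s, s ∉ q ∧ ∀ (n : ℕ) (f : MvPolynomial σ K),
      (n : ℕ∞) ≤ weightOrder (primeWeight q) f → s ^ n * f ∈ I ^ n := by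
  classical
  set s : MvPolynomial σ K := ∏ j ∈ Finset.univ.filter (fun j => X j ∉ q), X j with hs
  have hsX : ∀ i, X i ∈ q → s * X i ∈ I := by
    intro i hi
    rw [← hrad.radical, ← Ideal.sInf_minimalPrimes, Submodule.mem_sInf]
    intro q' hq'
    by_cases hle : ∃ j, X j ∉ q ∧ X j ∈ q'
    · obtain ⟨j, hj, hj'⟩ := hle
      exact Ideal.mul_mem_right _ _ (Ideal.mem_of_dvd _
        (Finset.dvd_prod_of_mem _ (by simpa using hj)) hj')
    · -- all variables of `q'` lie in `q`, so `q' ⊆ q`, and the two agree by minimality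
      push Not at hle
      have hq'q : q' ≤ q := by
        intro f hf
        rw [mem_iff_one_le_weightOrder hI hq', ← Nat.cast_one, le_weightOrder_iff] at hf
        rw [mem_iff_one_le_weightOrder hI hq, ← Nat.cast_one, le_weightOrder_iff]
        intro u hu
        obtain ⟨j, hj, hjq⟩ := (one_le_weight_primeWeight_iff u).mp (hf u hu)
        exact (one_le_weight_primeWeight_iff u).mpr
          ⟨j, hj, by_contra fun h => hle j h hjq⟩
      exact Ideal.mul_mem_left _ _ (hq.2 hq'.1 hq'q hi)
  have hmon : ∀ (n : ℕ) (u : σ →₀ ℕ), n ≤ Finsupp.weight (primeWeight q) u →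
      s ^ n * monomial u 1 ∈ I ^ n := by
    intro n
    induction n with
    | zero => intro u _; simp
    | succ n ih =>
      intro u hu
      obtain ⟨i, hi, hiq⟩ := (one_le_weight_primeWeight_iff u).mp (le_trans (by omega) hu)
      have hw := Finsupp.weight_sub_single_add (w := primeWeight q) hi
      have h1 : primeWeight q i = 1 := if_pos hiq
      have hu' : monomial u (1 : K) = monomial (u - Finsupp.single i 1) 1 * X i := by
        rw [X, monomial_mul, one_mul, Finsupp.sub_add_single_one_cancel hi]
      rw [hu', pow_succ, pow_succ, mul_mul_mul_comm]
      exact Ideal.mul_mem_mul (ih _ (by omega)) (hsX i hiq)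
  refine ⟨s, ?_, fun n f hf => ?_⟩
  · rw [hs, hq.1.1.prod_mem_iff]
    simp
  · rw [le_weightOrder_iff] at hf
    rw [f.as_sum, Finset.mul_sum]
    refine Ideal.sum_mem _ fun u hu => ?_
    rw [← mul_one (coeff u f), ← C_mul_monomial, mul_left_comm]
    exact Ideal.mul_mem_left _ _ (hmon n u (hf u hu))

/-- A polynomial lies in the `n`-th symbolic power of a radical monomial ideal exactly if it
vanishes to order at least `n` along every minimal prime. -/
theorem mem_symbolicPower_iff_forall_le_weightOrder [Fintype σ] (hI : IsMonomialIdeal I)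
    (hrad : I.IsRadical) {f : MvPolynomial σ K} {n : ℕ} :
    f ∈ symbolicPower I n ↔
      ∀ q ∈ I.minimalPrimes, (n : ℕ∞) ≤ weightOrder (primeWeight q) f := by
  constructor
  · intro hf q hq
    exact le_weightOrder_of_mem_symbolicPower hq (RingHom.id _) _
      (fun g hg => (mem_iff_one_le_weightOrder hI hq g).mp (hq.1.2 hg))
      (fun s hs => weightOrder_eq_zero_of_notMem hI hq hs) hf
  · intro h
    rw [mem_symbolicPower_iff]
    -- prime avoidance for the ideal of all `s` with `s f ∈ Iⁿ`
    let c : Ideal (MvPolynomial σ K) :=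
      Submodule.comap (LinearMap.mulRight (MvPolynomial σ K) f) (I ^ n)
    have hfin : I.minimalPrimes.Finite := I.finite_minimalPrimes_of_isNoetherianRing
    by_contra! hne
    have hsub : (c : Set (MvPolynomial σ K)) ⊆
        ⋃ q ∈ (hfin.toFinset : Set (Ideal (MvPolynomial σ K))), (q : Set (MvPolynomial σ K)) := by
      intro s hs
      by_contra hsq
      refine hne s (fun q hq hsq' => hsq ?_) hs
      simp only [Set.mem_iUnion]
      exact ⟨q, by simpa using hq, hsq'⟩
    obtain ⟨q, hq, hcq⟩ := (Ideal.subset_union_prime (f := fun q : Ideal (MvPolynomial σ K) => q)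
      ⊥ ⊥ fun q hq _ _ => (hfin.mem_toFinset.mp hq).1.1).mp hsub
    rw [hfin.mem_toFinset] at hq
    obtain ⟨s, hs, hsf⟩ := exists_notMem_forall_pow_mul_mem hI hrad hq
    have : s ^ n ∈ c := hsf n f (h q hq)
    exact hs (hq.1.1.mem_of_pow_mem _ (hcq this))

/-- A monomial filtration that starts with a radical ideal, lies below its symbolic powers, and
has finitely generated Rees algebra and reduced associated graded algebra contains the
symbolic powers.

A weight supporting the filtration at `u` is integral and positive on all variables of some
minimal prime of the first ideal, so it dominates the indicator weight of that prime. -/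
theorem symbolicPower_le_of_isReduced_gr [Fintype σ] {A : IdealFiltration (MvPolynomial σ K)}
    (hA : ∀ n, IsMonomialIdeal (A.toFun n)) (hA1 : A.toFun 1 = I) (hrad : I.IsRadical)
    (hI : I ≠ ⊤) (hle : ∀ n, A.toFun n ≤ symbolicPower I n) {k : ℕ} {b : Fin k → ℕ}
    (hb : A.GeneratingDegrees b) [IsReduced A.gr] (n : ℕ) : symbolicPower I n ≤ A.toFun n := by
  classical
  have hImon : IsMonomialIdeal I := hA1 ▸ hA 1
  have hfin : ∀ u : σ →₀ ℕ, ∃ N, ∀ n, monomial u (1 : K) ∈ A.toFun n → n ≤ N := by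
    intro u
    obtain ⟨q, hq⟩ := Ideal.nonempty_minimalPrimes hI
    refine ⟨Finsupp.weight (primeWeight q) u, fun n hn => ?_⟩
    have h := (mem_symbolicPower_iff_forall_le_weightOrder hImon hrad).mp (hle n hn) q hq
    exact le_weightOrder_iff.mp h u (by simp [support_monomial])
  intro f hf
  rw [mem_symbolicPower_iff_forall_le_weightOrder hImon hrad] at hf
  refine mem_of_forall_monomial_mem fun u hu => ?_
  obtain ⟨a, ha, hau⟩ := exists_weight_of_isReduced_gr hA hb hfin u
  -- the product of the variables of weight zero is not in `I`, hence misses some minimal prime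
  let c : σ →₀ ℕ := Finsupp.equivFunOnFinite.symm fun i => if a i = 0 then 1 else 0
  have hc : Finsupp.weight a c = 0 := by
    rw [Finsupp.weight_eq_sum]
    refine Finset.sum_eq_zero fun i _ => ?_
    by_cases h : a i = 0 <;> simp [c, h]
  have hcI : monomial c (1 : K) ∉ I := fun h => by
    have := ha c 1 (hA1 ▸ h)
    omega
  rw [← hrad.radical, ← Ideal.sInf_minimalPrimes, Submodule.mem_sInf] at hcI
  push Not at hcI
  obtain ⟨q, hq, hcq⟩ := hcI
  rw [monomial_mem_iff_of_isPrime hq.1.1] at hcq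
  push Not at hcq
  have hqa : ∀ i, primeWeight q i ≤ a i := by
    intro i
    by_cases h : X i ∈ q
    · have : a i ≠ 0 := fun h0 => hcq i (by simp [c, h0]) h
      rw [primeWeight, if_pos h]
      omega
    · rw [primeWeight, if_neg h]
      exact Nat.zero_le _
  refine A.antitone ?_ hau
  refine (le_weightOrder_iff.mp (hf q hq) u hu).trans ?_
  rw [Finsupp.weight_eq_sum, Finsupp.weight_eq_sum]
  exact Finset.sum_le_sum fun i _ => Nat.mul_le_mul_left _ (hqa i)

end MonomialPrime

/-! ### Initial ideals of symbolic powers -/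

section InitialIdealSymbolic

open MvPolynomial

variable {K : Type*} [Field K] {σ : Type*} (ord : MonomialOrder σ)

theorem mem_initialIdeal_iff {J : Ideal (MvPolynomial σ K)} {f : MvPolynomial σ K} :
    f ∈ initialIdeal ord J ↔ ∀ u ∈ f.support, ∃ g ∈ J, g ≠ 0 ∧ ord.degree g ≤ u := by
  have himg : (fun g : MvPolynomial σ K => monomial (ord.degree g) (1 : K)) ''
      ((J : Set (MvPolynomial σ K)) \ {0}) = (fun u => monomial u (1 : K)) ''
        (ord.degree '' ((J : Set (MvPolynomial σ K)) \ {0})) := by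
    rw [Set.image_image]
  rw [initialIdeal, ord.span_leadingTerm_eq_span_monomial', himg, mem_ideal_span_monomial_image]
  refine forall₂_congr fun u _ => ?_
  rw [Set.exists_mem_image]
  simp only [Set.mem_sdiff, SetLike.mem_coe, Set.mem_singleton_iff, and_assoc, ne_eq]

theorem monomial_mem_initialIdeal_iff {J : Ideal (MvPolynomial σ K)} {u : σ →₀ ℕ} :
    monomial u (1 : K) ∈ initialIdeal ord J ↔ ∃ g ∈ J, g ≠ 0 ∧ ord.degree g ≤ u := by
  classical
  rw [mem_initialIdeal_iff]
  simp [support_monomial]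

theorem isMonomialIdeal_initialIdeal (J : Ideal (MvPolynomial σ K)) :
    IsMonomialIdeal (initialIdeal ord J) := fun _ hf u hu =>
  (monomial_mem_initialIdeal_iff ord).mpr ((mem_initialIdeal_iff ord).mp hf u hu)

theorem initialIdeal_ne_top {J : Ideal (MvPolynomial σ K)} (hJ : J ≠ ⊤) :
    initialIdeal ord J ≠ ⊤ := by
  rw [Ne, Ideal.eq_top_iff_one]
  intro h
  obtain ⟨g, hg, hg0, hdeg⟩ := (mem_initialIdeal_iff ord).mp h 0 (by simp)
  have hgC := ord.eq_C_of_degree_eq_zero (le_antisymm hdeg (zero_le (a := ord.degree g)))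
  refine hJ (Ideal.eq_top_of_isUnit_mem _ hg ?_)
  rw [hgC]
  exact (isUnit_iff_ne_zero.mpr (ord.leadingCoeff_ne_zero_iff.mpr hg0)).map C

variable [Fintype σ]

/-- The Taylor expansion `f(x) ↦ f(x + y)`, as a polynomial in `y` with coefficients in `K[x]`. -/
noncomputable def taylorHom : MvPolynomial σ K →+* MvPolynomial σ (MvPolynomial σ K) :=
  eval₂Hom (C.comp C) fun i => C (X i) + X i

/-- The `y^α`-coefficient of the Taylor expansion is the divided-power derivative
`x^(α + w) ↦ ∏ᵢ (αᵢ + wᵢ choose αᵢ) x^w`. -/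
theorem coeff_coeff_taylorHom (f : MvPolynomial σ K) (α w : σ →₀ ℕ) :
    coeff w (coeff α (taylorHom f)) =
      ((∏ i, (α i + w i).choose (α i) : ℕ) : K) * coeff (α + w) f := by
  classical
  induction f using MvPolynomial.induction_on generalizing α w with
  | C r =>
    simp only [taylorHom, coe_eval₂Hom, eval₂_C, RingHom.comp_apply, coeff_C]
    by_cases hα : 0 = α
    · subst hα
      simp [coeff_C]
    · have : ¬ 0 = α + w := fun h => hα (add_eq_zero.mp h.symm).1.symm
      simp [hα, this]
  | add f g hf hg => rw [map_add, coeff_add, coeff_add, hf, hg, coeff_add, mul_add]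
  | mul_X f i hf =>
    have hX : taylorHom (X i : MvPolynomial σ K) = C (X i) + X i := by simp [taylorHom]
    rw [map_mul, hX, mul_add, coeff_add, mul_comm _ (C (X i)), coeff_C_mul, coeff_add,
      mul_comm (X i), coeff_mul_X', coeff_mul_X', coeff_mul_X', apply_ite (coeff w), coeff_zero, hf, hf]
    simp only [Finsupp.mem_support_iff, Finsupp.add_apply]
    rw [← Finset.mul_prod_erase Finset.univ _ (Finset.mem_univ i),
      ← Finset.mul_prod_erase Finset.univ _ (Finset.mem_univ i),
      ← Finset.mul_prod_erase Finset.univ _ (Finset.mem_univ i)]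
    have h1 : ∀ j ∈ Finset.univ.erase i, (α j + (w - Finsupp.single i 1 : σ →₀ ℕ) j).choose (α j) =
        (α j + w j).choose (α j) := fun j hj => by
      have : i ≠ j := (Finset.ne_of_mem_erase hj).symm
      simp [this]
    have h2 : ∀ j ∈ Finset.univ.erase i, ((α - Finsupp.single i 1 : σ →₀ ℕ) j + w j).choose
        ((α - Finsupp.single i 1 : σ →₀ ℕ) j) = (α j + w j).choose (α j) := fun j hj => by
      have : i ≠ j := (Finset.ne_of_mem_erase hj).symm
      simp [this]
    rw [Finset.prod_congr rfl h1, Finset.prod_congr rfl h2]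
    have e1 : w i ≠ 0 → α + (w - Finsupp.single i 1) = α + w - Finsupp.single i 1 := fun h => by
      ext j
      by_cases hj : i = j
      · subst hj; simp; omega
      · simp [hj]
    have e2 : α i ≠ 0 → α - Finsupp.single i 1 + w = α + w - Finsupp.single i 1 := fun h => by
      ext j
      by_cases hj : i = j
      · subst hj; simp; omega
      · simp [hj]
    -- Pascal's rule in the `i`-th factor
    rcases Nat.eq_zero_or_pos (w i) with hw | hw <;> rcases Nat.eq_zero_or_pos (α i) with hα | hα
    · simp [hw, hα]
    · have := e2 hα.ne'
      simp [hw, hα.ne', this]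
    · have := e1 hw.ne'
      simp [hw.ne', hα, this]
    · obtain ⟨a, ha⟩ := Nat.exists_eq_succ_of_ne_zero hα.ne'
      obtain ⟨c, hc⟩ := Nat.exists_eq_succ_of_ne_zero hw.ne'
      have hp : (a + 1 + (c + 1)).choose (a + 1) =
          (a + 1 + c).choose (a + 1) + (a + (c + 1)).choose a := by
        rw [show a + 1 + (c + 1) = (a + 1 + c) + 1 by ring, Nat.choose_succ_succ,
          show a + (c + 1) = a + 1 + c by ring, add_comm]
      rw [if_pos hw.ne', if_pos hα.ne', if_pos (by omega), e1 hw.ne', e2 hα.ne', ha, hc]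
      simp only [Finsupp.tsub_apply, Finsupp.single_eq_same, ha, hc, Nat.succ_eq_add_one,
        Nat.add_sub_cancel, hp]
      push_cast
      ring

/-- The Taylor coefficients of order less than `n` of an element of the `n`-th symbolic power of
a prime ideal lie in the prime ideal. -/
theorem coeff_taylorHom_mem_of_mem_symbolicPower {P : Ideal (MvPolynomial σ K)} (hP : P.IsPrime)
    {f : MvPolynomial σ K} {n : ℕ} (hf : f ∈ symbolicPower P n) {α : σ →₀ ℕ}
    (hα : Finsupp.weight (fun _ => 1) α < n) : coeff α (taylorHom f) ∈ P := by
  set ψ : MvPolynomial σ K →+* MvPolynomial σ (MvPolynomial σ K ⧸ P) :=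
    (MvPolynomial.map (Ideal.Quotient.mk P)).comp taylorHom with hψ
  have hcoeff : ∀ g α, coeff α (ψ g) = Ideal.Quotient.mk P (coeff α (taylorHom g)) := fun g α => by
    rw [hψ, RingHom.comp_apply, coeff_map]
  have h0 : ∀ g : MvPolynomial σ K, coeff 0 (taylorHom g) = g := fun g => by
    ext w
    rw [coeff_coeff_taylorHom]
    simp
  have hone : ∀ g, 1 ≤ weightOrder (fun _ => 1) (ψ g) ↔ g ∈ P := by
    intro g
    rw [← Nat.cast_one, le_weightOrder_iff, ← Ideal.Quotient.eq_zero_iff_mem]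
    conv_rhs => rw [← h0 g, ← hcoeff]
    constructor
    · intro h
      by_contra hne
      have := h 0 (mem_support_iff.mpr hne)
      simp at this
    · intro h u hu
      rw [Nat.one_le_iff_ne_zero]
      intro hu0
      have : u = 0 := by
        rw [← Finsupp.degree_eq_zero_iff, Finsupp.degree_eq_weight_one]
        exact hu0
      exact mem_support_iff.mp hu (this ▸ h)
  have hmin : P ∈ P.minimalPrimes := by
    rw [Ideal.minimalPrimes_eq_subsingleton_self]
    rfl
  have h := le_weightOrder_of_mem_symbolicPower hmin ψ (fun _ => 1) (fun g hg => (hone g).mpr hg)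
    (fun s hs => by
      rwa [← hone, Order.one_le_iff_ne_zero, not_not] at hs) hf
  rw [le_weightOrder_iff] at h
  rw [← Ideal.Quotient.eq_zero_iff_mem, ← hcoeff]
  by_contra hne
  exact absurd (h α (mem_support_iff.mpr hne)) (not_le.mpr hα)

/-- The leading monomial of an element of `P^(n)` vanishes to order at least `n` along every
prime `q` above the initial ideal of `P`.

Otherwise the divided-power derivative by the part of the leading monomial inside `q` would
produce an element of `P` whose leading monomial avoids `q`. -/
theorem le_weight_degree_of_mem_symbolicPower {P q : Ideal (MvPolynomial σ K)} (hP : P.IsPrime)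
    (hq : q.IsPrime) (hle : initialIdeal ord P ≤ q) {f : MvPolynomial σ K} {n : ℕ}
    (hf : f ∈ symbolicPower P n) (hf0 : f ≠ 0) :
    n ≤ Finsupp.weight (primeWeight q) (ord.degree f) := by
  classical
  by_contra! hlt
  set m := ord.degree f with hm
  set α := m.filter (fun i => X i ∈ q) with hα
  set w := m.filter (fun i => ¬ X i ∈ q) with hw
  have hsum : α + w = m := Finsupp.filter_add_filter_not m _
  have hαn : Finsupp.weight (fun _ => 1) α < n := by
    refine lt_of_eq_of_lt ?_ hlt
    rw [Finsupp.weight_eq_sum, Finsupp.weight_eq_sum]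
    refine Finset.sum_congr rfl fun i _ => ?_
    by_cases h : X i ∈ q <;> simp [hα, primeWeight, h]
  set g := coeff α (taylorHom f) with hg
  have hgP : g ∈ P := coeff_taylorHom_mem_of_mem_symbolicPower hP hf hαn
  have hgw : w ∈ g.support := by
    have h1 : ∏ i, (α i + w i).choose (α i) = 1 := by
      refine Finset.prod_eq_one fun i _ => ?_
      by_cases h : X i ∈ q <;> simp [hα, hw, h]
    rw [mem_support_iff, hg, coeff_coeff_taylorHom, h1, hsum, Nat.cast_one, one_mul]
    exact ord.leadingCoeff_ne_zero_iff.mpr hf0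
  have hg0 : g ≠ 0 := by
    rintro h
    simp [h] at hgw
  have hdeg : ord.degree g = w := by
    refine ord.toSyn.injective (le_antisymm ?_ (ord.le_degree hgw))
    have hmem : α + ord.degree g ∈ f.support := by
      have h := ord.degree_mem_support hg0
      rw [mem_support_iff, hg, coeff_coeff_taylorHom] at h
      exact mem_support_iff.mpr (right_ne_zero_of_mul h)
    have h := ord.le_degree hmem
    rw [← hm, ← hsum, map_add, map_add] at h
    exact le_of_add_le_add_left h
  have hwq : monomial w (1 : K) ∈ q :=
    hle ((monomial_mem_initialIdeal_iff ord).mpr ⟨g, hgP, hg0, hdeg.le⟩)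
  obtain ⟨i, hi, hiq⟩ := (monomial_mem_iff_of_isPrime hq w).mp hwq
  exact hi (by simp [hw, hiq])

theorem initialIdeal_symbolicPower_le {P : Ideal (MvPolynomial σ K)} (hP : P.IsPrime)
    (hrad : (initialIdeal ord P).IsRadical) (n : ℕ) :
    initialIdeal ord (symbolicPower P n) ≤ symbolicPower (initialIdeal ord P) n := by
  intro f hf
  rw [mem_symbolicPower_iff_forall_le_weightOrder (isMonomialIdeal_initialIdeal ord P) hrad]
  intro q hq
  rw [le_weightOrder_iff]
  intro u hu
  obtain ⟨g, hg, hg0, hgu⟩ := (mem_initialIdeal_iff ord).mp hf u hu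
  refine (le_weight_degree_of_mem_symbolicPower ord hP hq.1.1 hq.1.2 hg hg0).trans ?_
  obtain ⟨c, rfl⟩ := exists_add_of_le hgu
  rw [map_add]
  exact Nat.le_add_right _ _

end InitialIdealSymbolic

/-! ### Minimal primes of the associated graded algebra -/

section GradedMinimalPrimes

open MvPolynomial

theorem IdealFiltration.mem_grLocalizationKer_iff {R : Type*} [CommRing R]
    (F : IdealFiltration R) (q : Ideal R) [q.IsPrime] (x : F.gr) :
    x ∈ F.grLocalizationKer q ↔ ∃ s ∉ q, s • x = 0 := by
  have h := IsLocalizedModule.eq_zero_iff q.primeCompl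
    (TensorProduct.mk R (Localization.AtPrime q) F.gr 1) (m := x)
  have hcomm : x ∈ F.grLocalizationKer q ↔
      TensorProduct.mk R (Localization.AtPrime q) F.gr 1 x = 0 := by
    rw [IdealFiltration.grLocalizationKer, RingHom.mem_ker,
      ← (TensorProduct.comm R F.gr (Localization.AtPrime q)).map_eq_zero_iff]
    rfl
  rw [hcomm, h]
  exact ⟨fun ⟨s, hs⟩ => ⟨s, s.2, hs⟩, fun ⟨s, hs, hsx⟩ => ⟨⟨s, hs⟩, hsx⟩⟩

variable {K : Type*} [Field K] {σ : Type*} [Fintype σ] {I q : Ideal (MvPolynomial σ K)}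
  {A : IdealFiltration (MvPolynomial σ K)}

/-- In the associated graded algebra of the symbolic powers of a radical monomial ideal, the
kernel of localization at a minimal prime `q` consists of the elements whose components vanish
along `q` to higher order than their degree requires. -/
theorem toGr_mem_grLocalizationKer_iff (hI : IsMonomialIdeal I) (hrad : I.IsRadical)
    (hA : ∀ n, A.toFun n = symbolicPower I n) [q.IsPrime] (hq : q ∈ I.minimalPrimes)
    (x : A.rees) : A.toGr x ∈ A.grLocalizationKer q ↔
      ∀ n : ℕ, ((n + 1 : ℕ) : ℕ∞) ≤
        weightOrder (primeWeight q) ((x : (MvPolynomial σ K)[X]).coeff n) := by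
  rw [IdealFiltration.mem_grLocalizationKer_iff]
  constructor
  · rintro ⟨s, hs, hsx⟩ n
    rw [IdealFiltration.smul_toGr, IdealFiltration.toGr_eq_zero_iff] at hsx
    have h := hsx n
    rw [Subalgebra.coe_smul, Polynomial.coeff_smul, smul_eq_mul, hA,
      mem_symbolicPower_iff_forall_le_weightOrder hI hrad] at h
    have h := h q hq
    rwa [weightOrder_mul, weightOrder_eq_zero_of_notMem hI hq hs, zero_add] at h
  · intro h
    obtain ⟨s, hs, hsI⟩ := exists_notMem_forall_pow_mul_mem hI hrad hq
    set N := (x : (MvPolynomial σ K)[X]).natDegree + 1 with hN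
    refine ⟨s ^ N, fun h => hs (hq.1.1.mem_of_pow_mem _ h), ?_⟩
    rw [IdealFiltration.smul_toGr, IdealFiltration.toGr_eq_zero_iff]
    intro n
    rw [Subalgebra.coe_smul, Polynomial.coeff_smul, smul_eq_mul]
    rcases lt_or_ge (x : (MvPolynomial σ K)[X]).natDegree n with hn | hn
    · rw [Polynomial.coeff_eq_zero_of_natDegree_lt hn, mul_zero]
      exact Ideal.zero_mem _
    · have hmem := hsI (n + 1) _ (h n)
      obtain ⟨c, hc⟩ := Nat.exists_eq_add_of_le (show n + 1 ≤ N by omega)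
      rw [hc, pow_add, mul_right_comm]
      refine Ideal.mul_mem_right _ _ ?_
      rw [hA, mem_symbolicPower_iff]
      exact ⟨1, one_mem _, by rwa [one_mul]⟩

theorem le_weightOrder_coeff (hI : IsMonomialIdeal I) (hrad : I.IsRadical)
    (hA : ∀ n, A.toFun n = symbolicPower I n) (hq : q ∈ I.minimalPrimes) (x : A.rees) (n : ℕ) :
    (n : ℕ∞) ≤ weightOrder (primeWeight q) ((x : (MvPolynomial σ K)[X]).coeff n) :=
  (mem_symbolicPower_iff_forall_le_weightOrder hI hrad).mp (hA n ▸ x.2 n) q hq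

theorem comap_grLocalizationKer (hI : IsMonomialIdeal I) (hrad : I.IsRadical)
    (hA : ∀ n, A.toFun n = symbolicPower I n) [q.IsPrime] (hq : q ∈ I.minimalPrimes) :
    (A.grLocalizationKer q).comap (algebraMap (MvPolynomial σ K) A.gr) = q := by
  ext r
  rw [Ideal.mem_comap, IdealFiltration.algebraMap_gr,
    toGr_mem_grLocalizationKer_iff hI hrad hA hq, mem_iff_one_le_weightOrder hI hq]
  have hcoe : ((algebraMap (MvPolynomial σ K) A.rees r : A.rees) : (MvPolynomial σ K)[X]) =
      Polynomial.C r := rfl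
  simp only [hcoe, Polynomial.coeff_C]
  constructor
  · intro h
    simpa using h 0
  · intro h n
    rcases n with - | n
    · simpa using h
    · simp [weightOrder_zero]

/-- Localizing at a minimal prime `q` turns the symbolic powers into the powers of `q`, whose
order of vanishing is multiplicative; hence the kernel of localization is prime. -/
theorem isPrime_grLocalizationKer (hI : IsMonomialIdeal I) (hrad : I.IsRadical)
    (hA : ∀ n, A.toFun n = symbolicPower I n) [q.IsPrime] (hq : q ∈ I.minimalPrimes) :
    (A.grLocalizationKer q).IsPrime := by
  classical
  refine ⟨fun h => ?_, fun {a c} h => ?_⟩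
  · have hc := comap_grLocalizationKer hI hrad hA hq
    rw [h, Ideal.comap_top] at hc
    exact hq.1.1.ne_top hc.symm
  obtain ⟨x, rfl⟩ := A.toGr_surjective a
  obtain ⟨y, rfl⟩ := A.toGr_surjective c
  rw [← map_mul] at h
  simp only [toGr_mem_grLocalizationKer_iff hI hrad hA hq] at h ⊢
  by_contra! hne
  obtain ⟨hx, hy⟩ := hne
  -- the lowest components of `x` and `y` that do not vanish to excess order
  set i := Nat.find hx with hi
  set j := Nat.find hy with hj
  have hxi := Nat.find_spec hx
  have hyj := Nat.find_spec hy
  rw [← hi] at hxi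
  rw [← hj] at hyj
  have hxi' := le_weightOrder_coeff hI hrad hA hq x i
  have hyj' := le_weightOrder_coeff hI hrad hA hq y j
  have hsplit := h (i + j)
  rw [Subalgebra.coe_mul, Polynomial.coeff_mul, ← Finset.add_sum_erase _ _
    (show (i, j) ∈ Finset.HasAntidiagonal.antidiagonal (i + j) by simp), ← mem_weightIdeal] at hsplit
  rw [Ideal.add_mem_iff_left _ ?_] at hsplit
  · rw [mem_weightIdeal, weightOrder_mul] at hsplit
    have hxe : weightOrder (primeWeight q) ((x : (MvPolynomial σ K)[X]).coeff i) = i :=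
      le_antisymm (Order.le_of_lt_add_one (by exact_mod_cast hxi)) hxi'
    have hye : weightOrder (primeWeight q) ((y : (MvPolynomial σ K)[X]).coeff j) = j :=
      le_antisymm (Order.le_of_lt_add_one (by exact_mod_cast hyj)) hyj'
    rw [hxe, hye] at hsplit
    have : i + j + 1 ≤ i + j := by exact_mod_cast hsplit
    omega
  · refine Ideal.sum_mem _ fun st hst => ?_
    obtain ⟨s, t⟩ := st
    rw [Finset.mem_erase, Finset.HasAntidiagonal.mem_antidiagonal] at hst
    obtain ⟨hst1, hst2⟩ := hst
    rw [mem_weightIdeal, weightOrder_mul]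
    have hs' := le_weightOrder_coeff hI hrad hA hq x s
    have ht' := le_weightOrder_coeff hI hrad hA hq y t
    have hcases : s < i ∨ t < j := by
      by_contra! hcon
      exact hst1 (Prod.ext (by dsimp only at *; omega) (by dsimp only at *; omega))
    dsimp only at hst2
    rcases hcases with hs | ht
    · have := not_lt.mp (Nat.find_min hx hs)
      refine le_trans ?_ (add_le_add this ht')
      exact_mod_cast (by omega : i + j + 1 ≤ s + 1 + t)
    · have := not_lt.mp (Nat.find_min hy ht)
      refine le_trans ?_ (add_le_add hs' this)
      exact_mod_cast (by omega : i + j + 1 ≤ s + (t + 1))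

theorem grLocalizationKer_mem_minimalPrimes (hI : IsMonomialIdeal I) (hrad : I.IsRadical)
    (hA : ∀ n, A.toFun n = symbolicPower I n) [q.IsPrime] (hq : q ∈ I.minimalPrimes) :
    A.grLocalizationKer q ∈ minimalPrimes A.gr := by
  refine ⟨⟨isPrime_grLocalizationKer hI hrad hA hq, bot_le⟩, ?_⟩
  rintro Q ⟨hQ, -⟩ hle x hx
  obtain ⟨s, hs, hsx⟩ := (A.mem_grLocalizationKer_iff q x).mp hx
  rw [Algebra.smul_def] at hsx
  refine (hQ.mem_or_mem (hsx ▸ Q.zero_mem)).resolve_left fun h => hs ?_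
  rw [← comap_grLocalizationKer hI hrad hA hq]
  exact hle h

/-- The localization kernels at the minimal primes of `I` intersect in zero, so they exhaust the
minimal primes. -/
theorem exists_eq_grLocalizationKer (hI : IsMonomialIdeal I) (hrad : I.IsRadical)
    (hA : ∀ n, A.toFun n = symbolicPower I n) {Q : Ideal A.gr} (hQ : Q ∈ minimalPrimes A.gr) :
    ∃ (q : Ideal (MvPolynomial σ K)) (_ : q.IsPrime), q ∈ I.minimalPrimes ∧
      A.grLocalizationKer q = Q := by
  classical
  have hfin : I.minimalPrimes.Finite := I.finite_minimalPrimes_of_isNoetherianRing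
  have := hfin.fintype
  have hinf : Finset.univ.inf (fun q : I.minimalPrimes =>
      haveI := q.2.1.1; A.grLocalizationKer q.1) ≤ Q := by
    intro z hz
    obtain ⟨x, rfl⟩ := A.toGr_surjective z
    rw [Submodule.mem_finsetInf] at hz
    have : A.toGr x = 0 := by
      rw [IdealFiltration.toGr_eq_zero_iff]
      intro n
      rw [hA, mem_symbolicPower_iff_forall_le_weightOrder hI hrad]
      intro q hq
      have := hq.1.1
      exact (toGr_mem_grLocalizationKer_iff hI hrad hA hq x).mp
        (hz ⟨q, hq⟩ (Finset.mem_univ _)) n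
    rw [this]
    exact Q.zero_mem
  obtain ⟨⟨q, hq⟩, -, hle⟩ := (Ideal.IsPrime.inf_le' hQ.1.1).mp hinf
  have := hq.1.1
  exact ⟨q, hq.1.1, hq, le_antisymm hle
    (hQ.2 (grLocalizationKer_mem_minimalPrimes hI hrad hA hq).1 hle)⟩

/-- Sending `q` to the kernel of localization at `q` is a bijection from the minimal primes of a
radical monomial ideal onto those of the associated graded algebra of its symbolic powers. -/
theorem exists_equiv_minimalPrimes_gr (hI : IsMonomialIdeal I) (hrad : I.IsRadical)
    (hA : ∀ n, A.toFun n = symbolicPower I n) :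
    ∃ e : I.minimalPrimes ≃ minimalPrimes A.gr,
      ∀ (q : Ideal (MvPolynomial σ K)) [q.IsPrime] (hq : q ∈ I.minimalPrimes),
        (e ⟨q, hq⟩ : Ideal A.gr) = A.grLocalizationKer q ∧
          Ideal.comap (algebraMap (MvPolynomial σ K) A.gr) (e ⟨q, hq⟩ : Ideal A.gr) = q := by
  let e : I.minimalPrimes → minimalPrimes A.gr := fun q =>
    haveI := q.2.1.1
    ⟨A.grLocalizationKer q.1, grLocalizationKer_mem_minimalPrimes hI hrad hA q.2⟩
  have he : Function.Bijective e := by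
    constructor
    · intro q q' h
      have := q.2.1.1
      have := q'.2.1.1
      have h' : A.grLocalizationKer q.1 = A.grLocalizationKer q'.1 := congrArg Subtype.val h
      refine Subtype.ext ?_
      rw [← comap_grLocalizationKer hI hrad hA q.2, h', comap_grLocalizationKer hI hrad hA q'.2]
    · rintro ⟨Q, hQ⟩
      obtain ⟨q, hqp, hq, rfl⟩ := exists_eq_grLocalizationKer hI hrad hA hQ
      exact ⟨⟨q, hq⟩, rfl⟩
  exact ⟨Equiv.ofBijective e he, fun q _ hq => ⟨rfl, comap_grLocalizationKer hI hrad hA hq⟩⟩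

end GradedMinimalPrimes

theorem mainTheorem12 {K : Type*} [Field K] (p : ℕ) [Fact p.Prime] [CharP K p] [PerfectField K]
    (d : ℕ) (ord : MonomialOrder (Fin d))
    (P : Ideal (MvPolynomial (Fin d) K)) (hP : P.IsPrime)
    (hPhom : P.IsHomogeneous (MvPolynomial.homogeneousSubmodule (Fin d) K))
    (hrad : (initialIdeal ord P).IsRadical)
    (hNoeth : IsNoetherianRing (initialFiltration ord (symbolicFiltration P)).rees)
    (k : ℕ) (b : Fin k → ℕ)
    (hb : (initialFiltration ord (symbolicFiltration P)).GeneratingDegrees b)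
    (hlcm : Finset.univ.lcm b < p)
    (hred : IsReduced (initialFiltration ord (symbolicFiltration P)).gr) :
    (∃ e : (initialIdeal ord P).minimalPrimes ≃
        minimalPrimes (initialFiltration ord (symbolicFiltration P)).gr,
      ∀ (q : Ideal (MvPolynomial (Fin d) K)) [q.IsPrime]
        (hq : q ∈ (initialIdeal ord P).minimalPrimes),
        (e ⟨q, hq⟩ : Ideal (initialFiltration ord (symbolicFiltration P)).gr) =
            (initialFiltration ord (symbolicFiltration P)).grLocalizationKer q ∧
          Ideal.comap (algebraMap (MvPolynomial (Fin d) K)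
            (initialFiltration ord (symbolicFiltration P)).gr)
            (e ⟨q, hq⟩ : Ideal (initialFiltration ord (symbolicFiltration P)).gr) = q) ∧
      ∀ n : ℕ, initialIdeal ord (symbolicPower P n) = symbolicPower (initialIdeal ord P) n := by
  have hA1 : (initialFiltration ord (symbolicFiltration P)).toFun 1 = initialIdeal ord P :=
    congrArg (initialIdeal ord) (symbolicPower_one_of_isPrime hP)
  have hle := initialIdeal_symbolicPower_le ord hP hrad
  have heq : ∀ n : ℕ,
      initialIdeal ord (symbolicPower P n) = symbolicPower (initialIdeal ord P) n := fun n =>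
    le_antisymm (hle n) (symbolicPower_le_of_isReduced_gr
      (fun n => isMonomialIdeal_initialIdeal ord (symbolicPower P n)) hA1 hrad
      (initialIdeal_ne_top ord hP.ne_top) hle hb n)
  exact ⟨exists_equiv_minimalPrimes_gr (isMonomialIdeal_initialIdeal ord P) hrad heq, heq⟩
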